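/- Let $D\subset\mathbb{C}^n$ be a bounded strongly pseudoconvex domain, that is, a bounded, nonempty, connected open set for which there is a $C^2$ function $\psi\colon\mathbb{C}^n\to\mathbb{R}$ with $D=\{\psi<0\}$, $d\psi\neq 0$ at every point of $\partial D$, and $$\sum_{i,j=1}^n\frac{\partial^2\psi}{\partial z_i\partial\bar z_j}(p)\,v_i\bar v_j>0$$ for all $p\in\partial D$ and all $v\in\mathbb{C}^n\setminus\{0\}$ with $\sum_j\frac{\partial\psi}{\partial z_j}(p)\,v_j=0$. Let $k_D$ be the Kobayashi distance of $D$, that is, the largest pseudodistance on $D$ that is bounded above by the Lempert function $$\delta_D(z,w)=\inf\{k_\Delta(\zeta,\eta)\mid \text{there is a holomorphic }\varphi\colon\Delta\to D\text{ with }\varphi(\zeta)=z,\ \varphi(\eta)=w\},$$ where $k_\Delta(\zeta,\eta)=\operatorname{artanh}\left|\frac{\zeta-\eta}{1-\bar\eta\zeta}\right|$ is the Poincaré distance of the unit disk $\Delta\subset\mathbb{C}$; equivalently, $k_D(z,w)$ is the infimum of $\sum_{i=0}^{m-1}\delta_D(p_i,p_{i+1})$ over all finite chains $z=p_0,p_1,\dots,p_m=w$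 in $D$. Endow $D$ with the distance $\rho_D=\tanh k_D$. Let $d(z,\partial D)$ denote the Euclidean distance of $z$ from the boundary of $D$. Let $\Gamma=\{z_j\}\subset D$ be a (finite or infinite) sequence that is uniformly discrete, that is, there is $\delta>0$ with $\rho_D(z_j,z_k)\ge\delta$ for all $j\ne k$, and assume that $d(z_j,\partial D)<1$ for all $j$. Then $$\sum_{z_j\in\Gamma} d(z_j,\partial D)^{n}\,h\left(-\frac{1}{\log d(z_j,\partial D)}\right)<+\infty$$ for every (weakly) increasing function $h\colon\mathbb{R}^+\to\mathbb{R}^+$ (defined at least on $(0,+\infty)$, with values in $[0,+\infty)$) such that $$\sum_{m=1}^{+\infty}h\left(\frac1m\right)<+\infty.$$ -/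

import Mathlib

open scoped ENNReal

noncomputable section

/-- The Poincaré distance of the unit disk,
`k_Δ(ζ, η) = artanh r = (1/2) log ((1 + r) / (1 - r))` with `r = |ζ - η| / |1 - conj η * ζ|`. -/
def poincareDist (ζ η : ℂ) : ℝ :=
  Real.artanh ‖(ζ - η) / (1 - (starRingEnd ℂ) η * ζ)‖

/-- The Lempert function of `D ⊆ ℂⁿ`: the infimum of `k_Δ(ζ, η)` over all holomorphic maps
`φ : Δ → D` and all `ζ, η ∈ Δ` with `φ ζ = z`, `φ η = w` (it is `∞` if there are none). -/
def lempertFunction {n : ℕ} (D : Set (EuclideanSpace ℂ (Fin n)))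
    (z w : EuclideanSpace ℂ (Fin n)) : ℝ≥0∞ :=
  ⨅ (φ : ℂ → EuclideanSpace ℂ (Fin n)) (ζ : ℂ) (η : ℂ)
    (_ : DifferentiableOn ℂ φ (Metric.ball 0 1))
    (_ : Set.MapsTo φ (Metric.ball 0 1) D)
    (_ : ζ ∈ Metric.ball (0 : ℂ) 1) (_ : η ∈ Metric.ball (0 : ℂ) 1)
    (_ : φ ζ = z) (_ : φ η = w), ENNReal.ofReal (poincareDist ζ η)

/-- The Kobayashi pseudodistance of `D`, with values in `[0, ∞]`: the largest pseudodistance on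
`D` bounded above by the Lempert function, that is, the infimum over all chains
`z = p 0, p 1, …, p m = w` of points of `D` of the sums of the Lempert function along the chain. -/
def kobayashiEDist {n : ℕ} (D : Set (EuclideanSpace ℂ (Fin n)))
    (z w : EuclideanSpace ℂ (Fin n)) : ℝ≥0∞ :=
  ⨅ (m : ℕ) (p : ℕ → EuclideanSpace ℂ (Fin n)) (_ : ∀ i, p i ∈ D)
    (_ : p 0 = z) (_ : p m = w), ∑ i ∈ Finset.range m, lempertFunction D (p i) (p (i + 1))

/-- The Kobayashi pseudodistance `k_D` as a real number. For a connected open set `D` and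
`z, w ∈ D` the value of `kobayashiEDist D z w` is finite. -/
def kobayashiDist {n : ℕ} (D : Set (EuclideanSpace ℂ (Fin n)))
    (z w : EuclideanSpace ℂ (Fin n)) : ℝ :=
  (kobayashiEDist D z w).toReal

/-- The distance `ρ_D = tanh k_D`. -/
def rhoDist {n : ℕ} (D : Set (EuclideanSpace ℂ (Fin n)))
    (z w : EuclideanSpace ℂ (Fin n)) : ℝ :=
  Real.tanh (kobayashiDist D z w)

/-- A family of points is uniformly discrete for the distance `d` if there is `δ > 0` with
`d (x j) (x k) ≥ δ` for all `j ≠ k`. -/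
def IsUniformlyDiscrete {X ι : Type*} (d : X → X → ℝ) (x : ι → X) : Prop :=
  ∃ δ : ℝ, 0 < δ ∧ ∀ j k : ι, j ≠ k → δ ≤ d (x j) (x k)

/-- The Levi form `∑ ∂²ψ/∂z_i∂z̄_j (p) v_i conj(v_j)` of a real `C²` function `ψ`, written through
the real Hessian `H` of `ψ` at `p` as `(H(v, v) + H(iv, iv)) / 4`. -/
def leviForm {n : ℕ} (ψ : EuclideanSpace ℂ (Fin n) → ℝ) (p v : EuclideanSpace ℂ (Fin n)) : ℝ :=
  (1 / 4) * (fderiv ℝ (fderiv ℝ ψ) p v v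
    + fderiv ℝ (fderiv ℝ ψ) p (Complex.I • v) (Complex.I • v))

/-- The value `∂ψ_p(v) = ∑ ∂ψ/∂z_j (p) v_j` of the `(1,0)`-part of `dψ_p`, that is,
`(dψ_p(v) - i dψ_p(iv)) / 2`. -/
def delForm {n : ℕ} (ψ : EuclideanSpace ℂ (Fin n) → ℝ) (p v : EuclideanSpace ℂ (Fin n)) : ℂ :=
  (1 / 2) * ((fderiv ℝ ψ p v : ℂ) - Complex.I * (fderiv ℝ ψ p (Complex.I • v) : ℂ))

/-- `ψ` is a `C²` defining function of `D`: `D = {ψ < 0}` and `dψ` has no zero on `∂D`. -/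
structure IsDefiningFunction {n : ℕ} (ψ : EuclideanSpace ℂ (Fin n) → ℝ)
    (D : Set (EuclideanSpace ℂ (Fin n))) : Prop where
  contDiff : ContDiff ℝ 2 ψ
  eq_sublevel : D = {z | ψ z < 0}
  fderiv_ne_zero : ∀ p ∈ frontier D, fderiv ℝ ψ p ≠ 0

/-- `D` is a bounded strongly pseudoconvex domain: a bounded domain (nonempty, open, connected)
with `C²` boundary whose Levi form is positive definite on the complex tangent space
`{v | ∂ψ_p(v) = 0}` at each boundary point `p`. -/
structure IsBoundedStronglyPseudoconvexDomain {n : ℕ}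
    (D : Set (EuclideanSpace ℂ (Fin n))) : Prop where
  isOpen : IsOpen D
  isConnected : IsConnected D
  isBounded : Bornology.IsBounded D
  exists_defining : ∃ ψ : EuclideanSpace ℂ (Fin n) → ℝ, IsDefiningFunction ψ D ∧
    ∀ p ∈ frontier D, ∀ v : EuclideanSpace ℂ (Fin n), v ≠ 0 → delForm ψ p v = 0 →
      0 < leviForm ψ p v

end

open MeasureTheory Metric Set

/-! ### Defining functions and the distance to the boundary -/

section DefiningFunction

/-! The proof is a volume count. Write `d` for the boundary distance of a point `z` of `D`. Near the
boundary `-ψ` is comparable to `d`, so by Taylor's formula `D` contains a box about `z` of size of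
order `d` in one complex direction and `√d` in the others (`exists_complexBox_subset`). Its volume
is at least of order `d ^ (n + 1)`.

Linear discs inside this box show that a fixed smaller copy lies in a small Kobayashi ball about
`z`. Hence the small boxes about the points of a uniformly discrete family are disjoint. Those with
`d` between `t / e` and `t` lie in a collar `{-C t < ψ < 0}`, of volume `O(t)`
(`exists_measureReal_collar_le`), so there are at most `K / t ^ n` of them (`exists_card_shell_le`).

Taking `t = exp (-m)`, each shell with `m ≥ 1` contributes at most `K * h (1 / m)` to the series,
and the shell `m = 0` is finite (`summable_pow_mul_of_shell_count`). -/

theorem eq_zero_of_mem_frontier_sublevel {X : Type*} [TopologicalSpace X] {ψ : X → ℝ} {D : Set X}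
    (hψ : Continuous ψ) (hD : D = {z | ψ z < 0}) {p : X} (hp : p ∈ frontier D) : ψ p = 0 := by
  subst hD
  exact frontier_lt_subset_eq hψ continuous_const hp

variable {E : Type*} [NormedAddCommGroup E] [NormedSpace ℝ E]

/-- The distance from a point of `D` to the frontier of `D` is at most its distance to any point
outside `D`. -/
theorem infDist_frontier_le_dist {D : Set E} {z y : E} (hz : z ∈ D) (hy : y ∉ D) :
    infDist z (frontier D) ≤ dist z y := by
  -- A segment missing the frontier would be covered by the disjoint open sets `interior D` and
  -- `(closure D)ᶜ`, and connectedness would keep it in `D`.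
  obtain ⟨x, hx, hxf⟩ : (segment ℝ z y ∩ frontier D).Nonempty := by
    by_contra hne
    have hcover : segment ℝ z y ⊆ interior D ∪ (closure D)ᶜ := by
      intro x hx
      by_cases h : x ∈ closure D
      · left
        by_contra hi
        exact hne ⟨x, hx, h, hi⟩
      · exact Or.inr h
    have hdisj : Disjoint (interior D) (closure D)ᶜ :=
      disjoint_compl_right.mono_left interior_subset_closure
    have hzi : z ∈ interior D := by
      rcases hcover (left_mem_segment ℝ z y) with h | h
      · exact h
      · exact absurd (subset_closure hz) h
    have := (convex_segment z y).isPreconnected.subset_left_of_subset_union isOpen_interior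
      isClosed_closure.isOpen_compl hdisj hcover ⟨z, left_mem_segment ℝ z y, hzi⟩
    exact hy (interior_subset (this (right_mem_segment ℝ z y)))
  refine (infDist_le_dist_of_mem hxf).trans ?_
  rw [dist_comm z x, dist_comm z y, dist_eq_norm, dist_eq_norm]
  exact norm_sub_le_of_mem_segment hx

/-- Supplies the direction in which `ψ` grows; giving up a factor 2 avoids having to attain the
operator norm. -/
theorem exists_half_le_apply_of_le_norm {f : E →L[ℝ] ℝ} {a : ℝ} (ha : 0 < a) (hf : a ≤ ‖f‖) :
    ∃ g : E, ‖g‖ ≤ 1 ∧ a / 2 ≤ f g := by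
  by_contra! h
  have : ‖f‖ ≤ a / 2 := by
    refine ContinuousLinearMap.opNorm_le_of_unit_norm (by positivity) fun x hx => ?_
    rw [Real.norm_eq_abs, abs_le]
    have h1 := h x hx.le
    have h2 := h (-x) (by rw [norm_neg]; exact hx.le)
    rw [map_neg] at h2
    constructor <;> linarith
  linarith

variable [FiniteDimensional ℝ E] {ψ : E → ℝ}

theorem exists_norm_fderiv_le_of_contDiff {F : Type*} [NormedAddCommGroup F] [NormedSpace ℝ F]
    {f : E → F} (hf : ContDiff ℝ 1 f) (R : ℝ) :
    ∃ L : ℝ, 0 < L ∧ ∀ x ∈ closedBall (0 : E) R, ‖fderiv ℝ f x‖ ≤ L := by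
  have := FiniteDimensional.proper_real E
  obtain ⟨L, hL⟩ := (isCompact_closedBall (0 : E) R).exists_bound_of_continuousOn
    (hf.continuous_fderiv one_ne_zero).continuousOn
  exact ⟨max L 1, by positivity, fun x hx => (hL x hx).trans (le_max_left _ _)⟩

theorem exists_abs_sub_le_of_contDiff (hψ : ContDiff ℝ 1 ψ) (R : ℝ) :
    ∃ L : ℝ, 0 < L ∧ ∀ x ∈ closedBall (0 : E) R, ∀ y ∈ closedBall (0 : E) R,
      |ψ y - ψ x| ≤ L * ‖y - x‖ := by
  obtain ⟨L, hL0, hL⟩ := exists_norm_fderiv_le_of_contDiff hψ R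
  refine ⟨L, hL0, fun x hx y hy => ?_⟩
  exact (convex_closedBall (0 : E) R).norm_image_sub_le_of_norm_fderiv_le (𝕜 := ℝ)
    (fun x _ => (hψ.differentiable one_ne_zero) x) hL hx hy

/-- A second order Taylor estimate, uniform on balls. -/
theorem exists_taylor_le_of_contDiff (hψ : ContDiff ℝ 2 ψ) (R : ℝ) :
    ∃ M : ℝ, 0 < M ∧ ∀ x ∈ closedBall (0 : E) R, ∀ y ∈ closedBall (0 : E) R,
      |ψ y - ψ x - fderiv ℝ ψ x (y - x)| ≤ M * ‖y - x‖ ^ 2 := by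
  have h1 : ContDiff ℝ 1 (fderiv ℝ ψ) := hψ.fderiv_right (m := 1) (by norm_num)
  obtain ⟨M, hM0, hM⟩ := exists_norm_fderiv_le_of_contDiff h1 R
  refine ⟨M, hM0, fun x hx y hy => ?_⟩
  have hseg : segment ℝ x y ⊆ closedBall 0 R := (convex_closedBall (0 : E) R).segment_subset hx hy
  have := (convex_segment x y).norm_image_sub_le_of_norm_fderiv_le' (𝕜 := ℝ) (f := ψ)
    (φ := fderiv ℝ ψ x) (C := M * ‖y - x‖)
    (fun x _ => (hψ.differentiable two_ne_zero) x) (fun w hw => ?_)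
    (left_mem_segment ℝ x y) (right_mem_segment ℝ x y)
  · rw [Real.norm_eq_abs] at this
    linarith
  · have h2 := (convex_closedBall (0 : E) R).norm_image_sub_le_of_norm_fderiv_le (𝕜 := ℝ)
      (fun x _ => (h1.differentiable one_ne_zero) x) hM hx (hseg hw)
    exact h2.trans (mul_le_mul_of_nonneg_left (norm_sub_le_of_mem_segment hw) hM0.le)

variable {D : Set E}

/-- On a bounded sublevel set with regular boundary, `ψ` and `dψ` are not small
simultaneously. -/
theorem exists_le_abs_or_le_norm_fderiv (hψ : ContDiff ℝ 1 ψ) (hD : D = {z | ψ z < 0})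
    (hreg : ∀ p ∈ frontier D, fderiv ℝ ψ p ≠ 0) (hb : Bornology.IsBounded D) :
    ∃ a : ℝ, 0 < a ∧ ∀ x ∈ D, a ≤ |ψ x| ∨ a ≤ ‖fderiv ℝ ψ x‖ := by
  have := FiniteDimensional.proper_real E
  rcases D.eq_empty_or_nonempty with rfl | hne
  · exact ⟨1, one_pos, by simp⟩
  have hcont : Continuous fun x => |ψ x| + ‖fderiv ℝ ψ x‖ :=
    hψ.continuous.abs.add (hψ.continuous_fderiv one_ne_zero).norm
  obtain ⟨x₀, hx₀, hmin⟩ := hb.isCompact_closure.exists_isMinOn hne.closure hcont.continuousOn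
  have hpos : 0 < |ψ x₀| + ‖fderiv ℝ ψ x₀‖ := by
    rw [closure_eq_self_union_frontier] at hx₀
    rcases hx₀ with h | h
    · rw [hD] at h
      have := abs_pos.2 (LT.lt.ne (show ψ x₀ < 0 from h))
      positivity
    · have := norm_pos_iff.2 (hreg x₀ h)
      positivity
  refine ⟨(|ψ x₀| + ‖fderiv ℝ ψ x₀‖) / 2, by positivity, fun x hx => ?_⟩
  have h := hmin (subset_closure hx)
  simp only [mem_ofPred_eq] at h
  by_contra! hc
  linarith [hc.1, hc.2]

/-- The distance to the boundary is controlled by a regular defining function. -/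
theorem exists_infDist_frontier_le_mul_neg (hψ : ContDiff ℝ 2 ψ) (hD : D = {z | ψ z < 0})
    (hreg : ∀ p ∈ frontier D, fderiv ℝ ψ p ≠ 0) (hb : Bornology.IsBounded D) :
    ∃ C : ℝ, 0 < C ∧ ∀ z ∈ D, infDist z (frontier D) < 1 →
      infDist z (frontier D) ≤ C * (-ψ z) := by
  obtain ⟨a, ha, hag⟩ := exists_le_abs_or_le_norm_fderiv (hψ.of_le one_le_two) hD hreg hb
  obtain ⟨R, hR⟩ := hb.subset_closedBall 0
  obtain ⟨M, hM0, hM⟩ := exists_taylor_le_of_contDiff hψ (R + 1)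
  -- For `-ψ z < e` these bounds give in turn `‖dψ‖ ≥ a` at `z`, a step `t ≤ 1`, and a Taylor error
  -- `M t ^ 2 ≤ -ψ z`.
  obtain ⟨e, he0, hea, he1, he2⟩ : ∃ e : ℝ, 0 < e ∧ e ≤ a ∧ 4 * e ≤ a ∧ 16 * M * e ≤ a ^ 2 := by
    refine ⟨min (a / 4) (a ^ 2 / (16 * M)), by positivity, ?_, ?_, ?_⟩
    · exact (min_le_left _ _).trans (by linarith)
    · linarith [min_le_left (a / 4) (a ^ 2 / (16 * M))]
    · have := min_le_right (a / 4) (a ^ 2 / (16 * M))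
      rw [le_div_iff₀ (by positivity)] at this
      linarith
  refine ⟨max (1 / e) (4 / a), by positivity, fun z hz hz1 => ?_⟩
  have hzneg : ψ z < 0 := by rw [hD] at hz; exact hz
  by_cases hbig : e ≤ -ψ z
  · have h1 : 1 ≤ 1 / e * (-ψ z) := by
      rw [div_mul_eq_mul_div, one_mul, le_div_iff₀ he0]; linarith
    have h2 : 1 / e * (-ψ z) ≤ max (1 / e) (4 / a) * (-ψ z) :=
      mul_le_mul_of_nonneg_right (le_max_left _ _) (by linarith)
    linarith
  push Not at hbig
  have hgrad : a ≤ ‖fderiv ℝ ψ z‖ := by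
    rcases hag z hz with h | h
    · rw [abs_of_neg hzneg] at h; linarith
    · exact h
  obtain ⟨g, hg1, hg⟩ := exists_half_le_apply_of_le_norm ha hgrad
  -- Along `g` the linear term gains at least `t * (a / 2) = 2 * (-ψ z)`, the Taylor error costs at
  -- most `-ψ z`, so the step of length at most `t` leaves `D`.
  set t : ℝ := 4 / a * (-ψ z) with ht
  have ht0 : 0 < t := mul_pos (by positivity) (by linarith)
  have hta : t * a = 4 * (-ψ z) := by rw [ht]; field_simp
  have ht1 : t ≤ 1 := by
    have : t * a ≤ 1 * a := by linarith
    exact le_of_mul_le_mul_right this ha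
  have hnorm : ‖t • g‖ ≤ t := by
    rw [norm_smul, Real.norm_of_nonneg ht0.le]
    exact mul_le_of_le_one_right ht0.le hg1
  have hzR := hR hz
  rw [mem_closedBall_zero_iff] at hzR
  have hy : z + t • g ∉ D := by
    intro hy
    rw [hD] at hy
    have hT := hM z (by rw [mem_closedBall_zero_iff]; linarith) (z + t • g)
      (by rw [mem_closedBall_zero_iff]; linarith [norm_add_le z (t • g)])
    rw [add_sub_cancel_left, map_smul, smul_eq_mul] at hT
    have h1 := (abs_le.1 hT).1
    have h2 : M * ‖t • g‖ ^ 2 ≤ M * t ^ 2 := by gcongr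
    have h3 : t * (a / 2) ≤ t * fderiv ℝ ψ z g := mul_le_mul_of_nonneg_left hg ht0.le
    have h4 : M * t ^ 2 ≤ -ψ z := by
      have h5 : M * t ^ 2 * a ^ 2 = 16 * M * (-ψ z) * (-ψ z) := by
        have : M * t ^ 2 * a ^ 2 = M * (t * a) ^ 2 := by ring
        rw [this, hta]; ring
      have h6 : 16 * M * (-ψ z) * (-ψ z) ≤ a ^ 2 * (-ψ z) := by
        refine mul_le_mul_of_nonneg_right ?_ (by linarith)
        refine le_trans ?_ he2
        exact mul_le_mul_of_nonneg_left hbig.le (by positivity)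
      have h7 : M * t ^ 2 * a ^ 2 ≤ (-ψ z) * a ^ 2 := by linarith
      exact le_of_mul_le_mul_right h7 (by positivity)
    have hy' : ψ (z + t • g) < 0 := hy
    linarith
  calc infDist z (frontier D) ≤ dist z (z + t • g) := infDist_frontier_le_dist hz hy
    _ ≤ t := by rw [dist_self_add_right]; exact hnorm
    _ ≤ max (1 / e) (4 / a) * (-ψ z) :=
      mul_le_mul_of_nonneg_right (le_max_right _ _) (by linarith)

/-- Lipschitz bound between `z` and a nearest boundary point, where `ψ` vanishes. -/
theorem exists_neg_le_mul_infDist_frontier (hψ : ContDiff ℝ 1 ψ) (hD : D = {z | ψ z < 0})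
    (hb : Bornology.IsBounded D) (hne : (frontier D).Nonempty) :
    ∃ C : ℝ, 0 < C ∧ ∀ z ∈ D, -ψ z ≤ C * infDist z (frontier D) := by
  have := FiniteDimensional.proper_real E
  obtain ⟨R, hR⟩ := hb.subset_closedBall 0
  obtain ⟨L, hL0, hL⟩ := exists_abs_sub_le_of_contDiff hψ R
  refine ⟨L, hL0, fun z hz => ?_⟩
  obtain ⟨p, hp, hpd⟩ := isClosed_frontier.exists_infDist_eq_dist hne z
  have hpR : p ∈ closedBall 0 R := closure_minimal hR isClosed_closedBall hp.1
  have := hL z (hR hz) p hpR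
  rw [eq_zero_of_mem_frontier_sublevel hψ.continuous hD hp, ← dist_eq_norm, dist_comm,
    ← hpd] at this
  linarith [le_abs_self (0 - ψ z)]

/-! ### Volume of the collar -/

section Collar

variable [MeasurableSpace E] [BorelSpace E] (μ : Measure E) [μ.IsAddHaarMeasure]

/-- A layer of a function that grows at rate at least `b` in the direction `g` throughout a ball
has volume proportional to its height: sufficiently many translates of it are disjoint. -/
theorem measureReal_layer_le {p g : E} {r b : ℝ} (hr : 0 < r) (hb : 0 < b) (hg : ‖g‖ ≤ 1)
    (hψ : Continuous ψ)
    (hmono : ∀ x ∈ ball p r, ∀ s : ℝ, 0 ≤ s → x + s • g ∈ ball p r → ψ x + b * s ≤ ψ (x + s • g))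
    {t : ℝ} (ht : 0 < t) :
    μ.real {x ∈ ball p r | -t < ψ x ∧ ψ x < 0} ≤ μ.real (ball p (2 * r)) / (r * b) * t := by
  have := FiniteDimensional.proper_real E
  set S : Set E := {x ∈ ball p r | -t < ψ x ∧ ψ x < 0} with hS
  have hSo : IsOpen S :=
    isOpen_ball.inter ((isOpen_lt continuous_const hψ).inter (isOpen_lt hψ continuous_const))
  -- Moving by `τ • g` raises `ψ` by at least `t`, the height of the layer, so translates by
  -- multiples of `τ • g` are disjoint. The first `N + 1 ≥ r / τ` of them stay in the ball of radius
  -- `2 * r`.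
  set τ : ℝ := t / b with hτ
  have hτ0 : 0 < τ := by positivity
  set N : ℕ := ⌊r / τ⌋₊ with hN
  have hNτ : N * τ ≤ r := by
    have := Nat.floor_le (a := r / τ) (by positivity)
    rwa [le_div_iff₀ hτ0] at this
  have hN1 : r / τ ≤ (N : ℝ) + 1 := (Nat.lt_floor_add_one _).le
  set f : ℕ → Set E := fun k => (fun x => x - ((k : ℝ) * τ) • g) ⁻¹' S with hf
  have hfm : ∀ k, MeasurableSet (f k) := fun k =>
    (hSo.preimage (continuous_id.sub continuous_const)).measurableSet
  have hfμ : ∀ k, μ.real (f k) = μ.real S := by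
    intro k
    simp only [hf, Measure.real, sub_eq_add_neg, measure_preimage_add_right]
  have hlt : ∀ k l : ℕ, k < l → Disjoint (f k) (f l) := by
    intro k l hkl
    rw [Set.disjoint_left]
    rintro x ⟨hxk, hxk1, hxk2⟩ ⟨hxl, hxl1, hxl2⟩
    have hkl' : (1 : ℝ) ≤ (l : ℝ) - k := by
      have : ((k + 1 : ℕ) : ℝ) ≤ l := by exact_mod_cast hkl
      push_cast at this; linarith
    have e : x - ((l : ℝ) * τ) • g + (((l : ℝ) - k) * τ) • g = x - ((k : ℝ) * τ) • g := by
      module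
    have := hmono _ hxl (((l : ℝ) - k) * τ) (by positivity) (by rw [e]; exact hxk)
    rw [e] at this
    have h2 : b * τ ≤ b * (((l : ℝ) - k) * τ) := by
      gcongr; exact le_mul_of_one_le_left hτ0.le hkl'
    have h3 : b * τ = t := by rw [hτ]; field_simp
    linarith
  have hsub : (⋃ k ∈ Finset.range (N + 1), f k) ⊆ ball p (2 * r) := by
    intro x hx
    simp only [mem_iUnion, Finset.mem_range, exists_prop] at hx
    obtain ⟨k, hk, hxk, -⟩ := hx
    have hkN : (k : ℝ) * τ ≤ r := by
      refine le_trans ?_ hNτ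
      gcongr; omega
    have h1 : ‖((k : ℝ) * τ) • g‖ ≤ r := by
      rw [norm_smul, Real.norm_of_nonneg (by positivity)]
      exact (mul_le_of_le_one_right (by positivity) hg).trans hkN
    rw [mem_ball, dist_eq_norm] at hxk ⊢
    have e : x - p = (x - ((k : ℝ) * τ) • g - p) + ((k : ℝ) * τ) • g := by abel
    rw [e]
    linarith [norm_add_le (x - ((k : ℝ) * τ) • g - p) (((k : ℝ) * τ) • g)]
  have hfin : ∀ k ∈ Finset.range (N + 1), μ (f k) ≠ ⊤ := fun k hk =>
    measure_ne_top_of_subset ((subset_biUnion_of_mem (u := f) hk).trans hsub)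
      measure_ball_lt_top.ne
  have hsum : ((N : ℝ) + 1) * μ.real S ≤ μ.real (ball p (2 * r)) := by
    have h1 := measureReal_biUnion_finset (μ := μ) (s := Finset.range (N + 1)) (f := f)
      (fun k _ l _ hkl => by
        rcases lt_or_gt_of_ne hkl with h | h
        · exact hlt k l h
        · exact (hlt l k h).symm) (fun k _ => hfm k) hfin
    simp only [hfμ, Finset.sum_const, Finset.card_range, nsmul_eq_mul] at h1
    push_cast at h1
    rw [← h1]
    exact measureReal_mono hsub measure_ball_lt_top.ne
  have h1 : r / τ * μ.real S ≤ μ.real (ball p (2 * r)) :=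
    (mul_le_mul_of_nonneg_right hN1 measureReal_nonneg).trans hsum
  have e : r / τ = r * b / t := by rw [hτ]; field_simp
  rw [e, div_mul_eq_mul_div, div_le_iff₀ ht] at h1
  rw [div_mul_eq_mul_div, le_div_iff₀ (by positivity)]
  linarith

/-- The collar `{-t < ψ < 0}` of a bounded domain with regular defining function `ψ` has volume
at most proportional to `t`. -/
theorem exists_measureReal_collar_le (hψ : ContDiff ℝ 1 ψ) (hD : D = {z | ψ z < 0})
    (hreg : ∀ p ∈ frontier D, fderiv ℝ ψ p ≠ 0) (hb : Bornology.IsBounded D) :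
    ∃ C : ℝ, 0 < C ∧ ∀ t : ℝ, 0 < t → μ.real {x ∈ D | -t < ψ x} ≤ C * t := by
  have := FiniteDimensional.proper_real E
  obtain ⟨a, ha, hag⟩ := exists_le_abs_or_le_norm_fderiv hψ hD hreg hb
  -- The covering balls stick out of `D`, so `dψ` must be uniformly continuous on a neighbourhood of
  -- `D`. An oscillation below `a / 4` leaves slope at least `a / 2 - a / 4` along a fixed `g`.
  have hK : IsCompact (cthickening 1 D) := hb.cthickening.isCompact_closure.of_isClosed_subset
    isClosed_cthickening subset_closure
  obtain ⟨η, hη, hunif⟩ := Metric.uniformContinuousOn_iff.1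
    (hK.uniformContinuousOn_of_continuous (hψ.continuous_fderiv one_ne_zero).continuousOn)
    (a / 4) (by positivity)
  set r : ℝ := min (η / 2) (1 / 2) with hrdef
  have hr : 0 < r := by positivity
  have hrη : 2 * r ≤ η := by linarith [min_le_left (η / 2) (1 / 2)]
  have hr1 : 2 * r ≤ 1 := by linarith [min_le_right (η / 2) (1 / 2)]
  obtain ⟨T, hT, hcov⟩ := hb.isCompact_closure.elim_finite_subcover_image
    (b := closure D) (c := fun p => ball p r) (fun _ _ => isOpen_ball)
    (fun x hx => mem_biUnion hx (mem_ball_self hr))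
  obtain ⟨hTfin, hcov⟩ := hcov
  set C₁ : ℝ := ∑ p ∈ hTfin.toFinset, μ.real (ball p (2 * r)) / (r * (a / 4)) with hC₁
  have hC₁0 : 0 ≤ C₁ := Finset.sum_nonneg fun p _ => by positivity
  have hDfin : μ D ≠ ⊤ := hb.measure_lt_top.ne
  refine ⟨max (C₁ + 1) (μ.real D / a), by positivity, fun t ht => ?_⟩
  have hSD : {x ∈ D | -t < ψ x} ⊆ D := fun x hx => hx.1
  by_cases hta : a ≤ t
  · calc μ.real {x ∈ D | -t < ψ x} ≤ μ.real D := measureReal_mono hSD hDfin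
      _ ≤ μ.real D / a * t := by
        rw [div_mul_eq_mul_div, le_div_iff₀ ha]
        exact mul_le_mul_of_nonneg_left hta measureReal_nonneg
      _ ≤ _ := mul_le_mul_of_nonneg_right (le_max_right _ _) ht.le
  push Not at hta
  have hlocal : ∀ p, μ.real {x ∈ ball p r | -t < ψ x ∧ ψ x < 0} ≤
      μ.real (ball p (2 * r)) / (r * (a / 4)) * t := by
    intro p
    rcases ({x ∈ ball p r | -t < ψ x ∧ ψ x < 0}).eq_empty_or_nonempty with h | ⟨z, hz, hz1, hz2⟩
    · rw [h, measureReal_empty]; positivity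
    have hzD : z ∈ D := by rw [hD]; exact hz2
    have hgrad : a ≤ ‖fderiv ℝ ψ z‖ := by
      rcases hag z hzD with h | h
      · rw [abs_of_neg hz2] at h; linarith
      · exact h
    obtain ⟨g, hg1, hg⟩ := exists_half_le_apply_of_le_norm ha hgrad
    have hder : ∀ y ∈ ball p r, a / 4 ≤ fderiv ℝ ψ y g := by
      intro y hy
      have hyz : dist y z < 2 * r := by
        have := dist_triangle_right y z p
        rw [mem_ball] at hy hz
        linarith
      have hyK : y ∈ cthickening 1 D :=
        mem_cthickening_of_dist_le y z 1 D hzD (by linarith)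
      have h1 := hunif y hyK z (self_subset_cthickening D hzD) (by linarith)
      rw [dist_eq_norm] at h1
      have h2 := (fderiv ℝ ψ y - fderiv ℝ ψ z).le_opNorm g
      have h3 : ‖fderiv ℝ ψ y - fderiv ℝ ψ z‖ * ‖g‖ ≤ a / 4 :=
        (mul_le_of_le_one_right (norm_nonneg _) hg1).trans h1.le
      rw [sub_apply, Real.norm_eq_abs] at h2
      linarith [(abs_le.1 (h2.trans h3)).1]
    refine measureReal_layer_le μ hr (by positivity) hg1 hψ.continuous ?_ ht
    intro x hx s hs hxs
    have hline : ∀ u ∈ Icc (0 : ℝ) s, x + u • g ∈ ball p r := by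
      intro u hu
      rcases hs.eq_or_lt with rfl | hs
      · have : u = 0 := le_antisymm hu.2 hu.1
        simpa [this] using hx
      have := (convex_ball p r).add_smul_sub_mem hx hxs (t := u / s)
        ⟨div_nonneg hu.1 hs.le, (div_le_one hs).2 hu.2⟩
      rwa [add_sub_cancel_left, smul_smul, div_mul_cancel₀ _ hs.ne'] at this
    have hderiv : ∀ u : ℝ, HasDerivAt (fun u : ℝ => ψ (x + u • g)) (fderiv ℝ ψ (x + u • g) g) u := by
      intro u
      have h1 : HasDerivAt (fun u : ℝ => x + u • g) g u := by
        simpa using ((hasDerivAt_id u).smul_const g).const_add x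
      exact ((hψ.differentiable one_ne_zero) _).hasFDerivAt.comp_hasDerivAt u h1
    have := (convex_Icc (0 : ℝ) s).mul_sub_le_image_sub_of_le_deriv (C := a / 4)
      (f := fun u : ℝ => ψ (x + u • g))
      (fun u _ => (hderiv u).continuousAt.continuousWithinAt)
      (fun u _ => (hderiv u).differentiableAt.differentiableWithinAt)
      (fun u hu => by
        rw [(hderiv u).deriv]
        exact hder _ (hline u (interior_subset hu)))
      0 (left_mem_Icc.2 hs) s (right_mem_Icc.2 hs) hs
    simp only [zero_smul, add_zero, sub_zero] at this
    linarith
  have hsub : {x ∈ D | -t < ψ x} ⊆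
      ⋃ p ∈ hTfin.toFinset, {x ∈ ball p r | -t < ψ x ∧ ψ x < 0} := by
    rintro x ⟨hxD, hx⟩
    obtain ⟨p, hp, hxp⟩ := mem_iUnion₂.1 (hcov (subset_closure hxD))
    refine mem_iUnion₂.2 ⟨p, hTfin.mem_toFinset.2 hp, hxp, hx, ?_⟩
    rw [hD] at hxD; exact hxD
  have hfin : μ (⋃ p ∈ hTfin.toFinset, {x ∈ ball p r | -t < ψ x ∧ ψ x < 0}) ≠ ⊤ := by
    refine ((measure_biUnion_finset_le _ _).trans_lt (ENNReal.sum_lt_top.2 fun p _ => ?_)).ne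
    exact (measure_mono fun x hx => hx.1).trans_lt (measure_ball_lt_top (x := p) (r := r))
  calc μ.real {x ∈ D | -t < ψ x}
      ≤ μ.real (⋃ p ∈ hTfin.toFinset, {x ∈ ball p r | -t < ψ x ∧ ψ x < 0}) :=
        measureReal_mono hsub hfin
    _ ≤ ∑ p ∈ hTfin.toFinset, μ.real {x ∈ ball p r | -t < ψ x ∧ ψ x < 0} :=
        measureReal_biUnion_finset_le _ _
    _ ≤ ∑ p ∈ hTfin.toFinset, μ.real (ball p (2 * r)) / (r * (a / 4)) * t :=
        Finset.sum_le_sum fun p _ => hlocal p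
    _ = C₁ * t := by rw [hC₁, Finset.sum_mul]
    _ ≤ _ := mul_le_mul_of_nonneg_right (le_trans (by linarith) (le_max_left _ _)) ht.le

end Collar

end DefiningFunction
-- Anisotropic boxes and their volume
section ComplexBox

/-- A real linear functional on a complex Hilbert space is controlled by the component along a
single unit vector. -/
theorem exists_unit_abs_apply_le {E : Type*} [NormedAddCommGroup E] [InnerProductSpace ℂ E]
    [CompleteSpace E] [Nontrivial E] [NormedSpace ℝ E] [IsScalarTower ℝ ℂ E] (f : E →L[ℝ] ℝ) :
    ∃ ν : E, ‖ν‖ = 1 ∧ ∀ v, |f v| ≤ ‖f‖ * ‖inner ℂ ν v‖ := by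
  -- `f` is the real part of a complex functional of the same norm; `ν` is its normalised Riesz
  -- vector.
  set F : StrongDual ℂ E := StrongDual.extendRCLike f with hF
  have hre : ∀ v, f v = (F v).re := by
    intro v
    rw [hF, StrongDual.extendRCLike_apply]
    simp
  have hnorm : ‖F‖ = ‖f‖ := StrongDual.norm_extendRCLike f
  set w : E := (InnerProductSpace.toDual ℂ E).symm F with hw
  have hFw : ∀ v, F v = inner ℂ w v := fun v => by
    rw [hw, InnerProductSpace.toDual_symm_apply]
  have hwn : ‖w‖ = ‖f‖ := by rw [hw, LinearIsometryEquiv.norm_map, hnorm]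
  by_cases h0 : w = 0
  · obtain ⟨ν, hν⟩ := exists_norm_eq E (zero_le_one (α := ℝ))
    refine ⟨ν, hν, fun v => ?_⟩
    rw [hre, hFw, h0, inner_zero_left]
    simp only [Complex.zero_re, abs_zero]
    positivity
  · refine ⟨((‖w‖ : ℂ)⁻¹) • w, norm_smul_inv_norm h0, fun v => ?_⟩
    rw [hre, hFw, inner_smul_left, norm_mul, ← hwn]
    have : ‖w‖ ≠ 0 := norm_ne_zero_iff.2 h0
    simp only [map_inv₀, Complex.conj_ofReal, norm_inv, Complex.norm_real, norm_norm]
    rw [mul_inv_cancel_left₀ this]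
    exact Complex.abs_re_le_norm _

/-- The anisotropic box of size `r` in the complex direction `ν` and `√r` in the others. -/
def complexBox {E : Type*} [NormedAddCommGroup E] [InnerProductSpace ℂ E] (ν : E) (r : ℝ) : Set E :=
  {v | ‖inner ℂ ν v‖ < r ∧ ‖v‖ ^ 2 < r}

theorem isOpen_complexBox {E : Type*} [NormedAddCommGroup E] [InnerProductSpace ℂ E] (ν : E)
    (r : ℝ) : IsOpen (complexBox ν r) := by
  have h₁ : Continuous fun v : E => ‖inner ℂ ν v‖ := by fun_prop
  have h₂ : Continuous fun v : E => ‖v‖ ^ 2 := by fun_prop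
  exact (isOpen_lt h₁ continuous_const).inter (isOpen_lt h₂ continuous_const)

theorem smul_mem_complexBox {E : Type*} [NormedAddCommGroup E] [InnerProductSpace ℂ E] {ν v : E}
    {r : ℝ} {c : ℂ} (hc : ‖c‖ ≤ 1) (hv : v ∈ complexBox ν r) : c • v ∈ complexBox ν r := by
  refine ⟨?_, ?_⟩
  · rw [inner_smul_right, norm_mul]
    exact (mul_le_of_le_one_left (norm_nonneg _) hc).trans_lt hv.1
  · rw [norm_smul, mul_pow]
    exact (mul_le_of_le_one_left (by positivity) (pow_le_one₀ (norm_nonneg _) hc)).trans_lt hv.2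

/-- The factor `s ^ 2` is exact for the quadratic condition; for the linear one it suffices because
`s ^ 2 ≤ s`. -/
theorem inv_smul_mem_complexBox {E : Type*} [NormedAddCommGroup E] [InnerProductSpace ℂ E]
    {ν v : E} {r s : ℝ} (hr : 0 < r) (hs0 : 0 < s) (hs1 : s ≤ 1)
    (hv : v ∈ complexBox ν (s ^ 2 * r)) : ((s : ℂ)⁻¹) • v ∈ complexBox ν r := by
  have hn : ‖(s : ℂ)⁻¹‖ = s⁻¹ := by
    rw [norm_inv, Complex.norm_real, Real.norm_of_nonneg hs0.le]
  refine ⟨?_, ?_⟩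
  · rw [inner_smul_right, norm_mul, hn, inv_mul_lt_iff₀ hs0]
    refine hv.1.trans_le (mul_le_mul_of_nonneg_right ?_ hr.le)
    rw [sq]
    exact mul_le_of_le_one_left hs0.le hs1
  · rw [norm_smul, mul_pow, hn, inv_pow, inv_mul_lt_iff₀ (by positivity)]
    exact hv.2

theorem isOpen_coordinateBox (k : ℕ) (r : ℝ) :
    IsOpen {x : EuclideanSpace ℂ (Fin (k + 1)) | ‖x 0‖ < r ∧ ‖x‖ ^ 2 < r} := by
  have h₁ : Continuous fun x : EuclideanSpace ℂ (Fin (k + 1)) => ‖x 0‖ := by fun_prop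
  have h₂ : Continuous fun x : EuclideanSpace ℂ (Fin (k + 1)) => ‖x‖ ^ 2 := by fun_prop
  exact (isOpen_lt h₁ continuous_const).inter (isOpen_lt h₂ continuous_const)

/-- The box contains the polydisc of radii `r / m` (once) and `√r / m` (`k` times), `m = k + 1`,
whose volume is a constant times `r ^ 2 * r ^ k`. Uniqueness of Haar measure transfers this from the
product measure up to a positive factor. -/
theorem exists_le_measureReal_coordinateBox (k : ℕ) :
    ∃ c : ℝ, 0 < c ∧ ∀ r : ℝ, 0 < r → r ≤ 1 →
      c * r ^ (k + 2) ≤ (volume : Measure (EuclideanSpace ℂ (Fin (k + 1)))).real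
        {x | ‖x 0‖ < r ∧ ‖x‖ ^ 2 < r} := by
  set e := (PiLp.continuousLinearEquiv 2 ℝ (fun _ : Fin (k + 1) => ℂ)).symm with he
  set ν : Measure (EuclideanSpace ℂ (Fin (k + 1))) := Measure.map e volume with hν
  have : ν.IsAddHaarMeasure := e.isAddHaarMeasure_map volume
  set q := Measure.addHaarScalarFactor (volume : Measure (EuclideanSpace ℂ (Fin (k + 1)))) ν with hq
  have hvol : (volume : Measure (EuclideanSpace ℂ (Fin (k + 1)))) = q • ν :=
    Measure.isAddLeftInvariant_eq_smul _ _
  have hq0 : 0 < q := Measure.addHaarScalarFactor_pos_of_isAddHaarMeasure _ _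
  set m : ℝ := (k : ℝ) + 1 with hm
  have hm0 : 0 < m := by positivity
  have hm1 : 1 ≤ m := by rw [hm]; linarith [(k.cast_nonneg : (0 : ℝ) ≤ k)]
  refine ⟨q * (Real.pi ^ (k + 1) * (1 / m ^ 2) ^ (k + 1)), by positivity, fun r hr0 hr1 => ?_⟩
  set ρ : Fin (k + 1) → ℝ := Fin.cons (r / m) (fun _ => √r / m) with hρ
  set P : Set (Fin (k + 1) → ℂ) := Set.univ.pi fun i => ball (0 : ℂ) (ρ i) with hP
  set S : Set (EuclideanSpace ℂ (Fin (k + 1))) := {x | ‖x 0‖ < r ∧ ‖x‖ ^ 2 < r} with hS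
  have hrs : r ≤ √r := Real.le_sqrt_of_sq_le (by nlinarith)
  have hSo : IsOpen S := isOpen_coordinateBox k r
  have hsub : P ⊆ e ⁻¹' S := by
    intro x hx
    have hx' : ∀ i, ‖x i‖ < ρ i := fun i => by simpa using hx i (mem_univ i)
    have hle : ∀ i, ‖x i‖ < √r / m := by
      intro i
      refine (hx' i).trans_le ?_
      refine Fin.cases ?_ (fun j => ?_) i
      · simp only [hρ, Fin.cons_zero]; gcongr
      · simp only [hρ, Fin.cons_succ]; rfl
    have h0 : ‖x 0‖ < r := (hx' 0).trans_le (by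
      simp only [hρ, Fin.cons_zero]; exact div_le_self hr0.le hm1)
    refine ⟨h0, ?_⟩
    rw [EuclideanSpace.norm_sq_eq]
    calc ∑ i, ‖(e x) i‖ ^ 2 < ∑ _i : Fin (k + 1), (√r / m) ^ 2 :=
          Finset.sum_lt_sum_of_nonempty Finset.univ_nonempty fun i _ =>
            pow_lt_pow_left₀ (hle i) (norm_nonneg _) two_ne_zero
      _ = r / m := by
          rw [Finset.sum_const, Finset.card_univ, Fintype.card_fin, nsmul_eq_mul, div_pow,
            Real.sq_sqrt hr0.le, hm]
          push_cast
          field_simp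
      _ ≤ r := div_le_self hr0.le hm1
  have hρ0 : ∀ i, 0 ≤ ρ i := by
    intro i
    refine Fin.cases ?_ (fun j => ?_) i
    · simp only [hρ, Fin.cons_zero]; positivity
    · simp only [hρ, Fin.cons_succ]; positivity
  have hPvol : volume.real P = Real.pi ^ (k + 1) * (1 / m ^ 2) ^ (k + 1) * r ^ (k + 2) := by
    rw [hP, Measure.real, volume_pi_pi, ENNReal.toReal_prod]
    have : ∀ i, (volume (ball (0 : ℂ) (ρ i))).toReal = ρ i ^ 2 * Real.pi := by
      intro i
      rw [Complex.volume_ball, ENNReal.toReal_mul, ENNReal.toReal_pow,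
        ENNReal.toReal_ofReal (hρ0 i)]
      rfl
    simp only [this]
    rw [Fin.prod_univ_succ]
    simp only [hρ, Fin.cons_zero, Fin.cons_succ, Finset.prod_const, Finset.card_univ,
      Fintype.card_fin, div_pow, Real.sq_sqrt hr0.le, one_pow]
    rw [mul_pow, div_pow]
    field_simp
    ring
  have hSvol : (volume : Measure (EuclideanSpace ℂ (Fin (k + 1)))).real S =
      q * volume.real (e ⁻¹' S) := by
    rw [hvol, Measure.real, Measure.real, Measure.smul_apply, hν,
      Measure.map_apply e.continuous.measurable hSo.measurableSet]
    rw [ENNReal.smul_def, smul_eq_mul, ENNReal.toReal_mul, ENNReal.coe_toReal]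
  have hfin : volume (e ⁻¹' S) ≠ ⊤ := by
    have hSb : Bornology.IsBounded S := by
      refine (isBounded_ball (x := 0) (r := 1)).subset fun x hx => ?_
      rw [mem_ball_zero_iff]
      have := hx.2
      nlinarith [norm_nonneg x]
    have h1 : (volume : Measure (EuclideanSpace ℂ (Fin (k + 1)))) S ≠ ⊤ := hSb.measure_lt_top.ne
    intro htop
    apply h1
    rw [hvol, Measure.smul_apply, hν,
      Measure.map_apply e.continuous.measurable hSo.measurableSet, htop, ENNReal.smul_def,
      smul_eq_mul, ENNReal.mul_top]
    exact_mod_cast hq0.ne'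
  rw [hSvol, mul_assoc, ← hPvol]
  exact mul_le_mul_of_nonneg_left (measureReal_mono hsub hfin) q.2

/-- The box of size `r` in `ℂⁿ` has volume at least a constant times `rⁿ⁺¹`. -/
theorem exists_le_measureReal_complexBox (k : ℕ) :
    ∃ c : ℝ, 0 < c ∧ ∀ ν : EuclideanSpace ℂ (Fin (k + 1)), ‖ν‖ = 1 → ∀ r : ℝ, 0 < r → r ≤ 1 →
      c * r ^ (k + 2) ≤ volume.real (complexBox ν r) := by
  obtain ⟨c, hc, h⟩ := exists_le_measureReal_coordinateBox k
  refine ⟨c, hc, fun ν hν r hr0 hr1 => (h r hr0 hr1).trans_eq ?_⟩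
  -- Coordinates in an orthonormal basis starting with `ν` give an isometry onto the coordinate box,
  -- so the constant does not depend on `ν`.
  obtain ⟨b, hb⟩ := Orthonormal.exists_orthonormalBasis_extension_of_card_eq (𝕜 := ℂ)
    (E := EuclideanSpace ℂ (Fin (k + 1))) (ι := Fin (k + 1)) (by simp)
    (v := fun _ => ν) (s := {0}) (by
      refine ⟨fun i => by simpa using hν, fun i j hij => absurd (Subsingleton.elim i j) hij⟩)
  have hb0 : b 0 = ν := hb 0 rfl
  set U : EuclideanSpace ℂ (Fin (k + 1)) ≃ₗᵢ[ℝ] EuclideanSpace ℂ (Fin (k + 1)) :=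
    { b.repr.toLinearEquiv.restrictScalars ℝ with norm_map' := b.repr.norm_map } with hU
  have hUa : ∀ x, U x = b.repr x := fun _ => rfl
  have hpre : complexBox ν r = U ⁻¹' {x | ‖x 0‖ < r ∧ ‖x‖ ^ 2 < r} := by
    ext x
    simp only [complexBox, mem_preimage, mem_ofPred_eq, hUa, b.repr_apply_apply, hb0,
      LinearIsometryEquiv.norm_map]
  rw [hpre, Measure.real, Measure.real,
    U.measurePreserving.measure_preimage (isOpen_coordinateBox k r).measurableSet.nullMeasurableSet]

end ComplexBox

/-! ### Upper bounds for the Kobayashi distance -/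

section Kobayashi

variable {n : ℕ} {D : Set (EuclideanSpace ℂ (Fin n))} {z w : EuclideanSpace ℂ (Fin n)}

theorem lempertFunction_le {φ : ℂ → EuclideanSpace ℂ (Fin n)} {ζ η : ℂ}
    (hφ : DifferentiableOn ℂ φ (ball 0 1)) (hm : MapsTo φ (ball 0 1) D) (hζ : ζ ∈ ball (0 : ℂ) 1)
    (hη : η ∈ ball (0 : ℂ) 1) (hz : φ ζ = z) (hw : φ η = w) :
    lempertFunction D z w ≤ ENNReal.ofReal (poincareDist ζ η) :=
  iInf_le_of_le φ <| iInf_le_of_le ζ <| iInf_le_of_le η <| iInf_le_of_le hφ <|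
    iInf_le_of_le hm <| iInf_le_of_le hζ <| iInf_le_of_le hη <| iInf_le_of_le hz <|
      iInf_le_of_le hw le_rfl

theorem kobayashiEDist_le_add {p : EuclideanSpace ℂ (Fin n)} (hz : z ∈ D) (hp : p ∈ D)
    (hw : w ∈ D) :
    kobayashiEDist D z w ≤ lempertFunction D z p + lempertFunction D p w := by
  refine iInf_le_of_le 2 <| iInf_le_of_le
    (fun i => if i = 0 then z else if i = 1 then p else w) <| iInf_le_of_le ?_ <|
    iInf_le_of_le (by simp) <| iInf_le_of_le (by simp) ?_
  · intro i
    dsimp only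
    split_ifs <;> assumption
  · simp [Finset.sum_range_succ]

/-- If the linear disc through `z` and `z + s • v` lies in `D`, then the Lempert function of the
two points is at most `artanh s`. -/
theorem lempertFunction_add_smul_le {v : EuclideanSpace ℂ (Fin n)} {s : ℝ} (hs0 : 0 ≤ s)
    (hs1 : s < 1) (hv : ∀ ζ : ℂ, ‖ζ‖ < 1 → z + ζ • v ∈ D) :
    lempertFunction D z (z + (s : ℂ) • v) ≤ ENNReal.ofReal (Real.artanh s) ∧
      lempertFunction D (z + (s : ℂ) • v) z ≤ ENNReal.ofReal (Real.artanh s) := by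
  have hd : DifferentiableOn ℂ (fun ζ : ℂ => z + ζ • v) (ball 0 1) := by fun_prop
  have hm : MapsTo (fun ζ : ℂ => z + ζ • v) (ball 0 1) D := fun ζ hζ =>
    hv ζ (by simpa using hζ)
  have h0 : (0 : ℂ) ∈ ball (0 : ℂ) 1 := by simp
  have hs : (s : ℂ) ∈ ball (0 : ℂ) 1 := by simpa [abs_of_nonneg hs0] using hs1
  constructor
  · refine (lempertFunction_le hd hm h0 hs (by simp) rfl).trans_eq ?_
    simp [poincareDist, abs_of_nonneg hs0]
  · refine (lempertFunction_le hd hm hs h0 rfl (by simp)).trans_eq ?_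
    simp [poincareDist, abs_of_nonneg hs0]

theorem tanh_le_self {x : ℝ} (hx : 0 ≤ x) : Real.tanh x ≤ x := by
  have h : ∀ y : ℝ, HasDerivAt (fun y => y * Real.cosh y - Real.sinh y) (y * Real.sinh y) y := by
    intro y
    refine (((hasDerivAt_id y).mul (Real.hasDerivAt_cosh y)).sub
      (Real.hasDerivAt_sinh y)).congr_deriv ?_
    simp
  have hm : MonotoneOn (fun y => y * Real.cosh y - Real.sinh y) (Ici 0) := by
    refine monotoneOn_of_deriv_nonneg (convex_Ici 0)
      (fun y _ => (h y).continuousAt.continuousWithinAt)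
      (fun y _ => (h y).differentiableAt.differentiableWithinAt) fun y hy => ?_
    have hy0 : 0 ≤ y := interior_subset hy
    rw [(h y).deriv]
    exact mul_nonneg hy0 (Real.sinh_nonneg_iff.2 hy0)
  have := hm (mem_Ici.2 le_rfl) (mem_Ici.2 hx) hx
  simp only [zero_mul, Real.sinh_zero, sub_zero] at this
  rw [Real.tanh_eq_sinh_div_cosh, div_le_iff₀ (Real.cosh_pos x)]
  linarith

/-- Forces the centres of two small boxes to be close when the boxes share a point `p`. -/
theorem rhoDist_le_of_lempertFunction_le {p : EuclideanSpace ℂ (Fin n)} {r : ℝ} (hr : 0 ≤ r)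
    (hz : z ∈ D) (hp : p ∈ D) (hw : w ∈ D) (hzp : lempertFunction D z p ≤ ENNReal.ofReal r)
    (hpw : lempertFunction D p w ≤ ENNReal.ofReal r) : rhoDist D z w ≤ 2 * r := by
  have h : kobayashiEDist D z w ≤ ENNReal.ofReal (2 * r) := by
    refine (kobayashiEDist_le_add hz hp hw).trans ((add_le_add hzp hpw).trans_eq ?_)
    rw [← ENNReal.ofReal_add hr hr, two_mul]
  have h' : kobayashiDist D z w ≤ 2 * r := ENNReal.toReal_le_of_le_ofReal (by positivity) h
  exact (tanh_le_self ENNReal.toReal_nonneg).trans h'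

theorem rhoDist_self (hz : z ∈ D) : rhoDist D z z = 0 := by
  have h : kobayashiEDist D z z = 0 := by
    refine le_antisymm ?_ zero_le
    exact iInf_le_of_le 0 <| iInf_le_of_le (fun _ => z) <| iInf_le_of_le (fun _ => hz) <|
      iInf_le_of_le rfl <| iInf_le_of_le rfl (by simp)
  simp [rhoDist, kobayashiDist, h]

end Kobayashi
-- From shell counts to the series
section Counting

/-- A series over a family in `(0, 1)` of which at most `K t⁻ⁿ` members lie between `t / e`
and `t`. -/
theorem summable_pow_mul_of_shell_count {ι : Type*} {d : ι → ℝ} {n : ℕ} {K : ℝ}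
    (hd0 : ∀ j, 0 < d j) (hd1 : ∀ j, d j < 1)
    (hcount : ∀ t : ℝ, 0 < t → t ≤ 1 → ∀ F : Finset ι,
      (∀ j ∈ F, Real.exp (-1) * t ≤ d j ∧ d j ≤ t) → F.card * t ^ n ≤ K)
    {h : ℝ → ℝ} (h_nonneg : ∀ t, 0 < t → 0 ≤ h t) (h_mono : MonotoneOn h (Ioi 0))
    (h_sum : Summable fun m : ℕ => h (1 / ((m : ℝ) + 1))) :
    Summable fun j => d j ^ n * h (-(1 / Real.log (d j))) := by
  set f : ι → ℝ := fun j => d j ^ n * h (-(1 / Real.log (d j))) with hf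
  have hlog : ∀ j, 0 < -Real.log (d j) := fun j => neg_pos.2 (Real.log_neg (hd0 j) (hd1 j))
  have hf_eq : ∀ j, f j = d j ^ n * h (1 / (-Real.log (d j))) := fun j => by
    simp only [hf]; rw [one_div_neg_eq_neg_one_div]
  have hf0 : ∀ j, 0 ≤ f j := fun j => by
    rw [hf_eq]
    exact mul_nonneg (pow_nonneg (hd0 j).le n) (h_nonneg _ (one_div_pos.2 (hlog j)))
  set m : ι → ℕ := fun j => ⌊-Real.log (d j)⌋₊ with hm
  have hm_le : ∀ j, (m j : ℝ) ≤ -Real.log (d j) := fun j => Nat.floor_le (hlog j).le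
  have hm_lt : ∀ j, -Real.log (d j) < m j + 1 := fun j => Nat.lt_floor_add_one _
  have hshell : ∀ j, Real.exp (-1) * Real.exp (-(m j : ℝ)) ≤ d j ∧ d j ≤ Real.exp (-(m j : ℝ)) := by
    intro j
    constructor
    · rw [← Real.exp_add, ← Real.le_log_iff_exp_le (hd0 j)]
      linarith [hm_lt j]
    · rw [← Real.log_le_iff_le_exp (hd0 j)]
      linarith [hm_le j]
  have hcard : ∀ (k : ℕ) (F : Finset ι), (∀ j ∈ F, m j = k) →
      F.card * Real.exp (-(k : ℝ)) ^ n ≤ K := by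
    intro k F hF
    refine hcount _ (Real.exp_pos _) (Real.exp_le_one_iff.2 (by simp)) F fun j hj => ?_
    rw [← hF j hj]
    exact hshell j
  -- On the shell `m = 0` the argument of `h` is not bounded by any `1 / m`; its finitely many terms
  -- are discarded.
  have hfin : {j | m j = 0}.Finite := by
    by_contra hinf
    obtain ⟨F, hF, hFc⟩ := Set.Infinite.exists_subset_card_eq hinf (⌊K⌋₊ + 1)
    have h1 := hcard 0 F fun j hj => hF hj
    rw [hFc] at h1
    simp only [Nat.cast_zero, neg_zero, Real.exp_zero, one_pow, mul_one] at h1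
    push_cast at h1
    linarith [Nat.lt_floor_add_one K]
  set H : ℕ → ℝ := fun k => if k = 0 then 0 else h (1 / (k : ℝ)) with hH
  have hH0 : ∀ k, 0 ≤ H k := by
    intro k
    simp only [hH]
    split_ifs with hk
    · exact le_rfl
    · exact h_nonneg _ (one_div_pos.2 (by positivity))
  have hHs : Summable H := by
    rw [← summable_nat_add_iff 1]
    simpa [hH] using h_sum
  set g : ι → ℝ := fun j => if m j = 0 then 0 else f j with hg
  have hgs : Summable g := by
    classical
    have hg0 : ∀ j, 0 ≤ g j := fun j => by
      simp only [hg]; split_ifs; exacts [le_rfl, hf0 j]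
    have hgH : ∀ j, g j ≤ Real.exp (-(m j : ℝ)) ^ n * H (m j) := by
      intro j
      simp only [hg, hH]
      split_ifs with hj
      · simp
      have hmj : (0 : ℝ) < m j := by positivity
      rw [hf_eq]
      refine mul_le_mul (pow_le_pow_left₀ (hd0 j).le (hshell j).2 n) ?_
        (h_nonneg _ (one_div_pos.2 (hlog j))) (by positivity)
      exact h_mono (one_div_pos.2 (hlog j)) (one_div_pos.2 hmj)
        (one_div_le_one_div_of_le hmj (hm_le j))
    refine summable_of_sum_le (c := K * ∑' k, H k) hg0 fun F => ?_
    have hK : 0 ≤ K := by simpa using hcard 0 ∅ (by simp)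
    rw [← Finset.sum_fiberwise_of_maps_to (g := m) (t := F.image m)
      (fun j hj => Finset.mem_image_of_mem m hj)]
    calc ∑ k ∈ F.image m, ∑ j ∈ F with m j = k, g j ≤ ∑ k ∈ F.image m, K * H k := by
          refine Finset.sum_le_sum fun k _ => ?_
          calc ∑ j ∈ F with m j = k, g j
              ≤ ∑ j ∈ F with m j = k, Real.exp (-(k : ℝ)) ^ n * H k := by
                refine Finset.sum_le_sum fun j hj => ?_
                rw [← (Finset.mem_filter.1 hj).2]
                exact hgH j
            _ = (Finset.card {j ∈ F | m j = k} * Real.exp (-(k : ℝ)) ^ n) * H k := by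
                rw [Finset.sum_const, nsmul_eq_mul]; ring
            _ ≤ K * H k := mul_le_mul_of_nonneg_right
                (hcard k _ fun j hj => (Finset.mem_filter.1 hj).2) (hH0 k)
      _ = K * ∑ k ∈ F.image m, H k := by rw [Finset.mul_sum]
      _ ≤ K * ∑' k, H k :=
          mul_le_mul_of_nonneg_left (hHs.sum_le_tsum _ fun k _ => hH0 k) hK
  refine hgs.congr_cofinite ?_
  refine Filter.mem_cofinite.2 (hfin.subset fun j hj => ?_)
  by_contra hne
  exact hj (if_neg hne)

end Counting

/-! ### Boxes in the domain and the shell count -/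

section Domain

variable {k : ℕ} {D : Set (EuclideanSpace ℂ (Fin (k + 1)))} {ψ : EuclideanSpace ℂ (Fin (k + 1)) → ℝ}

/-- Around a point at distance `d` from the boundary, `D` contains a box of size comparable to `d`
in one complex direction and to `√d` in the others, on which `ψ` is comparable to `d`. -/
theorem exists_complexBox_subset (hψ : IsDefiningFunction ψ D) (hb : Bornology.IsBounded D)
    (hne : (frontier D).Nonempty) :
    ∃ ε C : ℝ, 0 < ε ∧ ε ≤ 1 ∧ 0 < C ∧ ∀ z ∈ D, infDist z (frontier D) < 1 →
      ∃ ν : EuclideanSpace ℂ (Fin (k + 1)), ‖ν‖ = 1 ∧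
        ∀ v ∈ complexBox ν (ε * infDist z (frontier D)),
          z + v ∈ D ∧ -(C * infDist z (frontier D)) < ψ (z + v) := by
  obtain ⟨R, hR⟩ := hb.subset_closedBall 0
  obtain ⟨L, hL0, hL⟩ := exists_norm_fderiv_le_of_contDiff (hψ.contDiff.of_le one_le_two) R
  obtain ⟨M, hM0, hM⟩ := exists_taylor_le_of_contDiff hψ.contDiff (R + 1)
  obtain ⟨C₁, hC₁, hdψ⟩ := exists_infDist_frontier_le_mul_neg hψ.contDiff hψ.eq_sublevel
    hψ.fderiv_ne_zero hb
  obtain ⟨C₂, hC₂, hψd⟩ := exists_neg_le_mul_infDist_frontier (hψ.contDiff.of_le one_le_two)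
    hψ.eq_sublevel hb hne
  -- On the box `ψ` varies by less than `(L + M) * ε * d ≤ d / C₁ ≤ -ψ z`, so it stays negative.
  obtain ⟨ε, hε0, hε1, hε⟩ : ∃ ε : ℝ, 0 < ε ∧ ε ≤ 1 ∧ C₁ * (L + M) * ε ≤ 1 := by
    refine ⟨min 1 (1 / (C₁ * (L + M))), by positivity, min_le_left _ _, ?_⟩
    calc C₁ * (L + M) * min 1 (1 / (C₁ * (L + M))) ≤ C₁ * (L + M) * (1 / (C₁ * (L + M))) := by
          gcongr; exact min_le_right _ _
      _ = 1 := by field_simp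
  refine ⟨ε, C₂ + L + M, hε0, hε1, by positivity, fun z hz hz1 => ?_⟩
  obtain ⟨ν, hν, hνf⟩ := exists_unit_abs_apply_le (fderiv ℝ ψ z)
  refine ⟨ν, hν, fun v hv => ?_⟩
  set d := infDist z (frontier D) with hd
  have hd0 : 0 ≤ d := infDist_nonneg
  have hεd0 : 0 < ε * d := (sq_nonneg _).trans_lt hv.2
  have hεd1 : ε * d ≤ d := mul_le_of_le_one_left hd0 hε1
  have hv1 : ‖v‖ ≤ 1 := by
    have := hv.2
    nlinarith [norm_nonneg v]
  have hzR := hR hz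
  have hgrad : |fderiv ℝ ψ z v| < L * (ε * d) := by
    refine (hνf v).trans_lt ?_
    calc ‖fderiv ℝ ψ z‖ * ‖inner ℂ ν v‖ ≤ L * ‖inner ℂ ν v‖ := by gcongr; exact hL z hzR
      _ < L * (ε * d) := mul_lt_mul_of_pos_left hv.1 hL0
  rw [mem_closedBall_zero_iff] at hzR
  have hT := hM z (by rw [mem_closedBall_zero_iff]; linarith) (z + v)
    (by rw [mem_closedBall_zero_iff]; linarith [norm_add_le z v])
  rw [add_sub_cancel_left] at hT
  have hMv : M * ‖v‖ ^ 2 < M * (ε * d) := mul_lt_mul_of_pos_left hv.2 hM0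
  have hlow := hdψ z hz hz1
  have hup := hψd z hz
  have h1 := abs_le.1 hT
  have h2 := abs_lt.1 hgrad
  constructor
  · rw [hψ.eq_sublevel]
    change ψ (z + v) < 0
    have h3 : (L + M) * (ε * d) ≤ -ψ z := by
      have h4 : C₁ * ((L + M) * (ε * d)) ≤ C₁ * (-ψ z) := by
        calc C₁ * ((L + M) * (ε * d)) = C₁ * (L + M) * ε * d := by ring
          _ ≤ 1 * d := mul_le_mul_of_nonneg_right hε hd0
          _ ≤ C₁ * (-ψ z) := by rw [one_mul]; exact hlow
      exact le_of_mul_le_mul_left h4 hC₁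
    linarith
  · have h3 : L * (ε * d) ≤ L * d := by gcongr
    have h4 : M * (ε * d) ≤ M * d := by gcongr
    linarith

/-- A uniformly discrete family has at most `K t⁻ⁿ` members at distance between `t / e` and `t`
from the boundary. -/
theorem exists_card_shell_le (hψ : IsDefiningFunction ψ D) (hb : Bornology.IsBounded D)
    (hne : (frontier D).Nonempty) {ι : Type*} {z : ι → EuclideanSpace ℂ (Fin (k + 1))}
    (hzD : ∀ j, z j ∈ D) (hz : IsUniformlyDiscrete (rhoDist D) z)
    (hz1 : ∀ j, infDist (z j) (frontier D) < 1) :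
    ∃ K : ℝ, ∀ t : ℝ, 0 < t → t ≤ 1 → ∀ F : Finset ι,
      (∀ j ∈ F, Real.exp (-1) * t ≤ infDist (z j) (frontier D) ∧
        infDist (z j) (frontier D) ≤ t) → F.card * t ^ (k + 1) ≤ K := by
  obtain ⟨δ, hδ, hsep⟩ := hz
  obtain ⟨ε, C, hε0, hε1, hC, hbox⟩ := exists_complexBox_subset hψ hb hne
  obtain ⟨c, hc, hvol⟩ := exists_le_measureReal_complexBox k
  obtain ⟨A, hA, hcollar⟩ := exists_measureReal_collar_le
    (volume : Measure (EuclideanSpace ℂ (Fin (k + 1)))) (hψ.contDiff.of_le one_le_two)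
    hψ.eq_sublevel hψ.fderiv_ne_zero hb
  choose ν hν hνD using fun j => hbox (z j) (hzD j) (hz1 j)
  -- Each point of a small box is within Lempert distance `δ / 4` of its centre, so overlapping
  -- boxes would have centres with `ρ_D ≤ δ / 2 < δ`.
  set s : ℝ := Real.tanh (δ / 4) with hs
  have hs0 : 0 < s := by
    rw [hs, Real.tanh_eq_sinh_div_cosh]
    exact div_pos (Real.sinh_pos_iff.2 (by positivity)) (Real.cosh_pos _)
  have hs1 : s < 1 := Real.tanh_lt_one _
  have hart : Real.artanh s = δ / 4 := Real.artanh_tanh _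
  set B : ι → Set (EuclideanSpace ℂ (Fin (k + 1))) := fun j =>
    (fun x => -z j + x) ⁻¹' complexBox (ν j) (s ^ 2 * (ε * infDist (z j) (frontier D))) with hB
  have hopen : ∀ j, IsOpen (B j) := fun j =>
    (isOpen_complexBox _ _).preimage (continuous_const.add continuous_id)
  have hBm : ∀ j x, x ∈ B j → x ∈ D ∧ -(C * infDist (z j) (frontier D)) < ψ x ∧
      lempertFunction D (z j) x ≤ ENNReal.ofReal (δ / 4) ∧
      lempertFunction D x (z j) ≤ ENNReal.ofReal (δ / 4) := by
    intro j x hx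
    have hpos : 0 < s ^ 2 * (ε * infDist (z j) (frontier D)) := (sq_nonneg _).trans_lt hx.2
    have hpos' : 0 < ε * infDist (z j) (frontier D) := pos_of_mul_pos_right hpos (sq_nonneg s)
    -- The shrinking by `s ^ 2` keeps `u` in the full box, hence the whole disc `z j + ζ • u` in
    -- `D`, with `x` at parameter `s`.
    set u := ((s : ℂ)⁻¹) • (-z j + x) with hu
    have hub : u ∈ complexBox (ν j) (ε * infDist (z j) (frontier D)) :=
      inv_smul_mem_complexBox hpos' hs0 hs1.le hx
    have hxu : z j + (s : ℂ) • u = x := by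
      rw [hu, smul_inv_smul₀ (by exact_mod_cast hs0.ne')]; abel
    have hsu : (s : ℂ) • u ∈ complexBox (ν j) (ε * infDist (z j) (frontier D)) :=
      smul_mem_complexBox (by rw [Complex.norm_real, Real.norm_of_nonneg hs0.le]; exact hs1.le) hub
    have h1 := hνD j _ hsu
    have h2 := lempertFunction_add_smul_le (D := D) (z := z j) (v := u) hs0.le hs1
      fun ζ hζ => (hνD j _ (smul_mem_complexBox hζ.le hub)).1
    rw [hxu] at h1 h2
    rw [hart] at h2
    exact ⟨h1.1, h1.2, h2⟩
  have hdisj : ∀ i j, i ≠ j → Disjoint (B i) (B j) := by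
    intro i j hij
    rw [Set.disjoint_left]
    intro x hxi hxj
    have := rhoDist_le_of_lempertFunction_le (by positivity) (hzD i) (hBm i x hxi).1 (hzD j)
      (hBm i x hxi).2.2.1 (hBm j x hxj).2.2.2
    linarith [hsep i j hij]
  set b : ℝ := c * (s ^ 2 * (ε * Real.exp (-1))) ^ (k + 2) with hbdef
  have hb0 : 0 < b := by positivity
  refine ⟨A * C / b, fun t ht0 ht1 F hF => ?_⟩
  have hBvol : ∀ j ∈ F, b * t ^ (k + 2) ≤ volume.real (B j) := by
    intro j hj
    have hdj := hF j hj
    have hd0 : 0 < infDist (z j) (frontier D) := lt_of_lt_of_le (by positivity) hdj.1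
    have hle : s ^ 2 * (ε * infDist (z j) (frontier D)) ≤ 1 := by
      have h1 : s ^ 2 ≤ 1 := pow_le_one₀ hs0.le hs1.le
      have h2 : ε * infDist (z j) (frontier D) ≤ 1 :=
        mul_le_one₀ hε1 hd0.le (hz1 j).le
      exact mul_le_one₀ h1 (by positivity) h2
    have h1 := hvol (ν j) (hν j) _ (by positivity) hle
    have h2 : volume.real (B j) =
        volume.real (complexBox (ν j) (s ^ 2 * (ε * infDist (z j) (frontier D)))) := by
      simp only [hB, Measure.real, measure_preimage_add]
    rw [h2]
    refine le_trans ?_ h1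
    rw [hbdef, mul_assoc, ← mul_pow]
    refine mul_le_mul_of_nonneg_left (pow_le_pow_left₀ (by positivity) ?_ _) hc.le
    calc s ^ 2 * (ε * Real.exp (-1)) * t = s ^ 2 * (ε * (Real.exp (-1) * t)) := by ring
      _ ≤ _ := by gcongr; exact hdj.1
  have hsub : (⋃ j ∈ F, B j) ⊆ {x ∈ D | -(C * t) < ψ x} := by
    intro x hx
    obtain ⟨j, hj, hxj⟩ := mem_iUnion₂.1 hx
    have h1 := hBm j x hxj
    have h2 : C * infDist (z j) (frontier D) ≤ C * t := by gcongr; exact (hF j hj).2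
    exact ⟨h1.1, by linarith [h1.2.1]⟩
  have hDfin : volume {x ∈ D | -(C * t) < ψ x} ≠ ⊤ :=
    (hb.subset fun x hx => hx.1).measure_lt_top.ne
  -- With `n = k + 1`, disjoint boxes of volume at least `b * t ^ (n + 1)` fill a collar of volume
  -- `O(t)`; cancelling one `t` leaves the exponent `n`.
  have hmain : F.card * (b * t ^ (k + 2)) ≤ A * (C * t) := by
    calc F.card * (b * t ^ (k + 2)) = ∑ _j ∈ F, b * t ^ (k + 2) := by
          rw [Finset.sum_const, nsmul_eq_mul]
      _ ≤ ∑ j ∈ F, volume.real (B j) := Finset.sum_le_sum hBvol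
      _ = volume.real (⋃ j ∈ F, B j) := by
          refine (measureReal_biUnion_finset (fun i _ j _ hij => hdisj i j hij)
            (fun j _ => (hopen j).measurableSet) fun j hj => ?_).symm
          exact measure_ne_top_of_subset ((subset_biUnion_of_mem (u := B) hj).trans hsub) hDfin
      _ ≤ volume.real {x ∈ D | -(C * t) < ψ x} := measureReal_mono hsub hDfin
      _ ≤ A * (C * t) := hcollar _ (by positivity)
  rw [le_div_iff₀ hb0]
  have : (F.card * t ^ (k + 1) * b) * t ≤ (A * C) * t := by
    calc (F.card * t ^ (k + 1) * b) * t = F.card * (b * t ^ (k + 2)) := by ring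
      _ ≤ A * (C * t) := hmain
      _ = (A * C) * t := by ring
  exact le_of_mul_le_mul_right this ht0

end Domain

theorem theorem3p6 {n : ℕ} (D : Set (EuclideanSpace ℂ (Fin n)))
    (hD : IsBoundedStronglyPseudoconvexDomain D)
    {ι : Type*} [Countable ι] (z : ι → EuclideanSpace ℂ (Fin n)) (hzD : ∀ j, z j ∈ D)
    (hz : IsUniformlyDiscrete (rhoDist D) z)
    (hz1 : ∀ j, Metric.infDist (z j) (frontier D) < 1)
    (h : ℝ → ℝ) (h_nonneg : ∀ t, 0 < t → 0 ≤ h t) (h_mono : MonotoneOn h (Set.Ioi 0))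
    (h_sum : Summable fun m : ℕ => h (1 / ((m : ℝ) + 1))) :
    Summable fun j : ι =>
      Metric.infDist (z j) (frontier D) ^ n *
        h (-(1 / Real.log (Metric.infDist (z j) (frontier D)))) := by
  -- For `n = 0` the space is one point, so separation leaves at most one index; the frontier is
  -- nonempty only for `n ≥ 1`.
  rcases n with _ | k
  · obtain ⟨δ, hδ, hsep⟩ := hz
    have : Subsingleton ι := by
      refine ⟨fun i j => ?_⟩
      by_contra hij
      have h1 := hsep i j hij
      rw [Subsingleton.elim (z j) (z i), rhoDist_self (hzD i)] at h1
      linarith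
    exact Summable.of_finite
  obtain ⟨ψ, hψ, -⟩ := hD.exists_defining
  have hne : (frontier D).Nonempty :=
    nonempty_frontier_iff.2 ⟨hD.isConnected.nonempty, fun hu =>
      NormedSpace.unbounded_univ ℂ (EuclideanSpace ℂ (Fin (k + 1))) (hu ▸ hD.isBounded)⟩
  obtain ⟨K, hK⟩ := exists_card_shell_le hψ hD.isBounded hne hzD hz hz1
  refine summable_pow_mul_of_shell_count (fun j => ?_) hz1 hK h_nonneg h_mono h_sum
  refine (isClosed_frontier.notMem_iff_infDist_pos hne).1 fun hf => ?_
  exact (hD.isOpen.inter_frontier_eq).le ⟨hzD j, hf⟩
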